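/- Order $\mathbb R^3$ componentwise, with positive cone $\mathbb R^3_+$. For $A\subset\mathbb R^3$, a linear subspace $M\subset\mathbb R^3$ and a linear functional $\pi:M\to\mathbb R$ put \[ \rho(x)=\inf\{\pi(z)\,;\ z\in M,\ z+x\in A\}\in[-\infty,\infty],\qquad \mathcal R(x)=\{z\in M\,;\ z+x\in A,\ \pi(z)=\rho(x)\}\qquad(x\in\mathbb R^3). \] A selection of $\mathcal R$ is a map $s:\mathbb R^3\to M$ with $s(x)\in\mathcal R(x)$ for all $x$. The triple $(A,M,\pi)$ is called admissible if (R1) $A$ is closed, convex, contains $0$, and $x\in A$, $y\in x+\mathbb R^3_+$ imply $y\in A$; (R2) $\pi(z)>0$ for every $z\in (M\cap\mathbb R^3_+)\setminus\{0\}$; (R3) $\rho$ is finite and continuous. Let $C=E_1\cup E_2\cup E_3\cup E_4\subset\mathbb R^2$, where \[ \begin{aligned} E_1&=\{4(u-\tfrac12)^2+v^2\le 1,\ u\in[\tfrac12,1],\ v\in[0,1]\}, & E_2&=\{\tfrac49(u-\tfrac12)^2+v^2\le 1,\ u\in[-1,\tfrac12],\ v\in[0,1]\},\\ E_3&=\{4(u+\tfrac12)^2+v^2\le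 1,\ u\in[-1,-\tfrac12],\ v\in[-1,0]\}, & E_4&=\{\tfrac49(u+\tfrac12)^2+v^2\le 1,\ u\in[-\tfrac12,1],\ v\in[-1,0]\}. \end{aligned} \] Let $r=16$, \[ B_r(C)=\{(u\sqrt{1+r^2t},\,v\,r\sqrt t,\,t)\,;\ (u,v)\in C,\ t\in[0,1]\},\qquad \Phi(x)=\begin{pmatrix}\tfrac1{\sqrt2}&\tfrac1{\sqrt6}&\tfrac1{\sqrt3}\\-\tfrac1{\sqrt2}&\tfrac1{\sqrt6}&\tfrac1{\sqrt3}\\0&-\tfrac{\sqrt2}{\sqrt3}&\tfrac1{\sqrt3}\end{pmatrix}x, \] and let $A=\Phi(B_{16}(C))+\mathbb R^3_+$, $M=\Phi(\{w\in\mathbb R^3\,;\ w_2=0\})$ and $\pi(z)=z_3$ for $z\in M$. Then: (a) $(A,M,\pi)$ is admissible, $\rho$ is Lipschitz continuous, and $\mathcal R(x)\neq\emptyset$ for every $x\in\mathbb R^3$. (b) For $n\ge1$ let $y^{(2n-1)}=(0,-\tfrac{r}{\sqrt n},0)$ and $y^{(2n)}=(0,\tfrac{r}{\sqrt n},0)$.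 Then $\Phi(y^{(k)})\to0$ as $k\to\infty$ and, for every $n\ge1$, \[ \mathcal R(\Phi(y^{(2n-1)}))=\Big\{\Phi\Big(-\tfrac12\sqrt{1+\tfrac{r^2}{n}},\,0,\,\tfrac1n\Big)\Big\},\qquad \mathcal R(\Phi(y^{(2n)}))=\Big\{\Phi\Big(\tfrac12\sqrt{1+\tfrac{r^2}{n}},\,0,\,\tfrac1n\Big)\Big\}. \] As $n\to\infty$ these optimal payoffs converge to $\Phi(-\tfrac12,0,0)$ and $\Phi(\tfrac12,0,0)$ respectively, and these two limits are different. (c) No selection of $\mathcal R$ is continuous at $0$. -/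

import Mathlib

open scoped Pointwise

noncomputable section

namespace RiskSelection

/-! ### The optimal value function, the optimal set mapping, admissible triples -/

section General

variable {X : Type*} [AddCommGroup X] [Module ℝ X]

/-- The optimal value function `ρ(x) = inf {π(z) ; z ∈ M, z + x ∈ A}`, with values in the
extended reals (the infimum of the empty set is `⊤`). -/
def riskMeasure (A : Set X) (M : Submodule ℝ X) (price : M →ₗ[ℝ] ℝ) (x : X) : EReal :=
  sInf {c : EReal | ∃ z : M, (z : X) + x ∈ A ∧ c = ((price z : ℝ) : EReal)}

/-- The optimal set mapping `x ↦ {z ∈ M ; z + x ∈ A, π(z) = ρ(x)}`, with values subsets of `M`. -/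
def optimalSet (A : Set X) (M : Submodule ℝ X) (price : M →ₗ[ℝ] ℝ) (x : X) : Set M :=
  {z : M | (z : X) + x ∈ A ∧ ((price z : ℝ) : EReal) = riskMeasure A M price x}

/-- A selection of a set-valued map. -/
def IsSelection {S T : Type*} (F : S → Set T) (s : S → T) : Prop :=
  ∀ x, s x ∈ F x

/-- Admissible triples `(A, M, π)`; the positive cone is `{x ; 0 ≤ x}`. -/
structure Admissible [TopologicalSpace X] [PartialOrder X]
    (A : Set X) (M : Submodule ℝ X) (price : M →ₗ[ℝ] ℝ) : Prop where
  isClosed : IsClosed A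
  convex : Convex ℝ A
  zero_mem : (0 : X) ∈ A
  monotone : ∀ x ∈ A, ∀ y, 0 ≤ y - x → y ∈ A
  noArbitrage : ∀ z : M, 0 ≤ (z : X) → (z : X) ≠ 0 → 0 < price z
  finite : ∀ x, riskMeasure A M price x ≠ ⊥ ∧ riskMeasure A M price x ≠ ⊤
  continuous : Continuous (riskMeasure A M price)

end General

/-! ### The example in `ℝ³`

`ℝ³` is `Fin 3 → ℝ` with its componentwise order; the coordinates `x₁, x₂, x₃` are
`x 0, x 1, x 2`. -/

/-- The set `B_r(E) = {(u √(1 + r² t), v r √t, t) ; (u, v) ∈ E, t ∈ [0, 1]}`. -/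
def twistedSet (r : ℝ) (E : Set (ℝ × ℝ)) : Set (Fin 3 → ℝ) :=
  {x | ∃ u v t : ℝ, (u, v) ∈ E ∧ t ∈ Set.Icc (0 : ℝ) 1 ∧
    x = ![u * √(1 + r ^ 2 * t), v * r * √t, t]}

def quarter1 : Set (ℝ × ℝ) :=
  {p | 4 * (p.1 - 1 / 2) ^ 2 + p.2 ^ 2 ≤ 1 ∧
    p.1 ∈ Set.Icc (1 / 2 : ℝ) 1 ∧ p.2 ∈ Set.Icc (0 : ℝ) 1}

def quarter2 : Set (ℝ × ℝ) :=
  {p | 4 / 9 * (p.1 - 1 / 2) ^ 2 + p.2 ^ 2 ≤ 1 ∧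
    p.1 ∈ Set.Icc (-1 : ℝ) (1 / 2) ∧ p.2 ∈ Set.Icc (0 : ℝ) 1}

def quarter3 : Set (ℝ × ℝ) :=
  {p | 4 * (p.1 + 1 / 2) ^ 2 + p.2 ^ 2 ≤ 1 ∧
    p.1 ∈ Set.Icc (-1 : ℝ) (-(1 / 2)) ∧ p.2 ∈ Set.Icc (-1 : ℝ) 0}

def quarter4 : Set (ℝ × ℝ) :=
  {p | 4 / 9 * (p.1 + 1 / 2) ^ 2 + p.2 ^ 2 ≤ 1 ∧
    p.1 ∈ Set.Icc (-(1 / 2) : ℝ) 1 ∧ p.2 ∈ Set.Icc (-1 : ℝ) 0}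

/-- The set `C`, the union of four quarters of ellipses. -/
def fourQuarters : Set (ℝ × ℝ) :=
  quarter1 ∪ quarter2 ∪ quarter3 ∪ quarter4

/-- The rotation `Φ`. -/
def rotationPhi : (Fin 3 → ℝ) →ₗ[ℝ] (Fin 3 → ℝ) :=
  Matrix.toLin' !![1 / √2, 1 / √6, 1 / √3;
    -(1 / √2), 1 / √6, 1 / √3;
    0, -(√2 / √3), 1 / √3]

/-- The acceptance set `Φ(B_16(C)) + ℝ³₊`. -/
def acceptanceSet : Set (Fin 3 → ℝ) :=
  rotationPhi '' twistedSet 16 fourQuarters + {p : Fin 3 → ℝ | 0 ≤ p}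

/-- The payoff space `Φ({w ; w₂ = 0})`. -/
def payoffSpace : Submodule ℝ (Fin 3 → ℝ) :=
  (LinearMap.ker (LinearMap.proj (R := ℝ) (φ := fun _ : Fin 3 => ℝ) 1)).map rotationPhi

/-- The pricing functional `z ↦ z₃` on the payoff space. -/
def pricing : payoffSpace →ₗ[ℝ] ℝ :=
  (LinearMap.proj (R := ℝ) (φ := fun _ : Fin 3 => ℝ) 2).domRestrict payoffSpace

/-- The sequence `y^(2n-1) = (0, -16/√n, 0)`, `y^(2n) = (0, 16/√n, 0)`, for `n ≥ 1`. -/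
def perturbation (k : ℕ) : Fin 3 → ℝ :=
  if Even k then ![0, 16 / √((k : ℝ) / 2), 0] else ![0, -(16 / √(((k : ℝ) + 1) / 2)), 0]

end RiskSelection

end

open RiskSelection

open scoped Pointwise
open RiskSelection

namespace RiskSelection

/-! ### The planar set and its support function -/

/-! The height-`t` slice of `twistedSet` is `C` stretched by `√(1 + r²t)` and `r√t`. As `t → 0` it
collapses to the segment `[-1, 1]`, but its extreme points in the second direction stay at `u = 1/2`
(top) and `u = -1/2` (bottom). Shifting by `±r√t` in that direction makes the top or bottom point of
a slice the unique optimum, so optimal payoffs approach two different limits along a sequence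
tending to `0`.

Convexity is the delicate point. The set is convex if the support function of its slices is concave
in `t` in every direction. By central symmetry two quadrants suffice (`concaveOn_slice_support`,
`concaveOn_slice_support_neg`), and `exists_mem_fourQuarters_combo` turns this back into membership.

On the payoff space the price is the mean of the coordinates, and constants belong to that space.
This gives compact feasible sets and the Lipschitz bound. Optimality along the perturbations is
`accepted_bound`: the rotated cone is too narrow, compared with `r = 16`, for its elements to
improve on the slice point. -/

lemma neg_mem_fourQuarters {u v : ℝ} (h : (u, v) ∈ fourQuarters) : (-u, -v) ∈ fourQuarters := by
  simp only [fourQuarters, quarter1, quarter2, quarter3, quarter4, Set.mem_union,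
    Set.mem_ofPred_eq, Set.mem_Icc] at h ⊢
  rcases h with ((⟨h, ⟨h1, h2⟩, h3, h4⟩ | ⟨h, ⟨h1, h2⟩, h3, h4⟩) | ⟨h, ⟨h1, h2⟩, h3, h4⟩) |
    ⟨h, ⟨h1, h2⟩, h3, h4⟩
  · exact Or.inl (Or.inr ⟨by nlinarith, ⟨by linarith, by linarith⟩, by linarith, by linarith⟩)
  · exact Or.inr ⟨by nlinarith, ⟨by linarith, by linarith⟩, by linarith, by linarith⟩
  · exact Or.inl (Or.inl (Or.inl
      ⟨by nlinarith, ⟨by linarith, by linarith⟩, by linarith, by linarith⟩))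
  · exact Or.inl (Or.inl (Or.inr
      ⟨by nlinarith, ⟨by linarith, by linarith⟩, by linarith, by linarith⟩))

lemma abs_le_one_of_mem_fourQuarters {u v : ℝ} (h : (u, v) ∈ fourQuarters) :
    |u| ≤ 1 ∧ |v| ≤ 1 := by
  simp only [fourQuarters, quarter1, quarter2, quarter3, quarter4, Set.mem_union,
    Set.mem_ofPred_eq, Set.mem_Icc] at h
  rw [abs_le, abs_le]
  rcases h with ((⟨h, ⟨h1, h2⟩, h3, h4⟩ | ⟨h, ⟨h1, h2⟩, h3, h4⟩) | ⟨h, ⟨h1, h2⟩, h3, h4⟩) |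
    ⟨h, ⟨h1, h2⟩, h3, h4⟩ <;>
  exact ⟨⟨by linarith, by linarith⟩, by linarith, by linarith⟩

/-- The support function of `fourQuarters` in the first quadrant. -/
lemma support_le_of_mem {u v a b : ℝ} (h : (u, v) ∈ fourQuarters) (ha : 0 ≤ a) (hb : 0 ≤ b) :
    a * u + b * v ≤ a / 2 + √(a ^ 2 / 4 + b ^ 2) := by
  suffices H : a * (u - 1 / 2) + b * v ≤ √(a ^ 2 / 4 + b ^ 2) by linarith
  simp only [fourQuarters, quarter1, quarter2, quarter3, quarter4, Set.mem_union,
    Set.mem_ofPred_eq, Set.mem_Icc] at h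
  rcases h with ((⟨h, ⟨h1, h2⟩, h3, h4⟩ | ⟨h, ⟨h1, h2⟩, h3, h4⟩) | ⟨h, ⟨h1, h2⟩, h3, h4⟩) |
    ⟨h, ⟨h1, h2⟩, h3, h4⟩
  -- Cauchy–Schwarz for `(a/2, b)` and `(2(u - 1/2), v)`. In the other quarters one of the two
  -- summands is nonpositive.
  · apply Real.le_sqrt_of_sq_le
    nlinarith [sq_nonneg (a / 2 * v - b * (2 * (u - 1 / 2))),
      mul_nonneg (sub_nonneg.2 h) (add_nonneg (sq_nonneg (a / 2)) (sq_nonneg b))]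
  · apply (show _ ≤ b by nlinarith).trans
    exact Real.le_sqrt_of_sq_le (by nlinarith)
  all_goals
    apply (show _ ≤ a / 2 by nlinarith).trans
    exact Real.le_sqrt_of_sq_le (by nlinarith)

/-- The support function of `fourQuarters` in the second quadrant. -/
lemma support_neg_le_of_mem {u v a b : ℝ} (h : (u, v) ∈ fourQuarters) (ha : 0 ≤ a) (hb : 0 ≤ b) :
    -a * u + b * v ≤ -(a / 2) + √(9 * a ^ 2 / 4 + b ^ 2) := by
  suffices H : a * (1 / 2 - u) + b * v ≤ √(9 * a ^ 2 / 4 + b ^ 2) by linarith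
  simp only [fourQuarters, quarter1, quarter2, quarter3, quarter4, Set.mem_union,
    Set.mem_ofPred_eq, Set.mem_Icc] at h
  rcases h with ((⟨h, ⟨h1, h2⟩, h3, h4⟩ | ⟨h, ⟨h1, h2⟩, h3, h4⟩) | ⟨h, ⟨h1, h2⟩, h3, h4⟩) |
    ⟨h, ⟨h1, h2⟩, h3, h4⟩
  · apply (show _ ≤ b by nlinarith).trans
    exact Real.le_sqrt_of_sq_le (by nlinarith)
  · apply Real.le_sqrt_of_sq_le
    nlinarith [sq_nonneg (3 * a / 2 * v - b * (2 / 3 * (1 / 2 - u))),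
      mul_nonneg (sub_nonneg.2 h) (add_nonneg (sq_nonneg (3 * a / 2)) (sq_nonneg b))]
  all_goals
    apply (show _ ≤ 3 * a / 2 by nlinarith).trans
    exact Real.le_sqrt_of_sq_le (by nlinarith)

lemma le_one_of_le_sqrt {q : ℝ} (h : q ≤ √q) : q ≤ 1 := by
  by_contra hq
  have h1 : √q ^ 2 = q := Real.sq_sqrt (by linarith)
  nlinarith [Real.sqrt_nonneg q]

/-- Test the support inequality in the direction of the gradient of the relevant ellipse form `q` at
`(u, v)`. Both the linear term and the radicand then equal `q`, so `q ≤ √q` and hence `q ≤ 1`. -/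
lemma mem_fourQuarters_of_support_of_nonneg {u v : ℝ} (hv : 0 ≤ v)
    (h₁ : ∀ a b : ℝ, 0 ≤ a → 0 ≤ b → a * u + b * v ≤ a / 2 + √(a ^ 2 / 4 + b ^ 2))
    (h₂ : ∀ a b : ℝ, 0 ≤ a → 0 ≤ b → -a * u + b * v ≤ -(a / 2) + √(9 * a ^ 2 / 4 + b ^ 2)) :
    (u, v) ∈ fourQuarters := by
  rcases le_total (1 / 2) u with hu | hu
  · have h := h₁ (4 * (u - 1 / 2)) v (by linarith) hv
    have e : (4 * (u - 1 / 2)) ^ 2 / 4 + v ^ 2 = 4 * (u - 1 / 2) ^ 2 + v ^ 2 := by ring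
    rw [e] at h
    have hq : 4 * (u - 1 / 2) ^ 2 + v ^ 2 ≤ 1 := le_one_of_le_sqrt (by linarith)
    exact Or.inl (Or.inl (Or.inl ⟨hq, ⟨hu, by nlinarith⟩, hv, by nlinarith⟩))
  · have h := h₂ (4 / 9 * (1 / 2 - u)) v (by linarith) hv
    have e : 9 * (4 / 9 * (1 / 2 - u)) ^ 2 / 4 + v ^ 2 = 4 / 9 * (u - 1 / 2) ^ 2 + v ^ 2 := by ring
    rw [e] at h
    have hq : 4 / 9 * (u - 1 / 2) ^ 2 + v ^ 2 ≤ 1 := le_one_of_le_sqrt (by linarith)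
    exact Or.inl (Or.inl (Or.inr ⟨hq, ⟨by nlinarith, hu⟩, hv, by nlinarith⟩))

/-- `fourQuarters` is cut out by its supporting half-planes. -/
lemma mem_fourQuarters_of_support {u v : ℝ}
    (h₁ : ∀ a b : ℝ, 0 ≤ a → 0 ≤ b → |a * u + b * v| ≤ a / 2 + √(a ^ 2 / 4 + b ^ 2))
    (h₂ : ∀ a b : ℝ, 0 ≤ a → 0 ≤ b → |-a * u + b * v| ≤ -(a / 2) + √(9 * a ^ 2 / 4 + b ^ 2)) :
    (u, v) ∈ fourQuarters := by
  rcases le_total 0 v with hv | hv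
  · exact mem_fourQuarters_of_support_of_nonneg hv
      (fun a b ha hb => (abs_le.1 (h₁ a b ha hb)).2) fun a b ha hb => (abs_le.1 (h₂ a b ha hb)).2
  · have := mem_fourQuarters_of_support_of_nonneg (u := -u) (v := -v) (by linarith)
      (fun a b ha hb => by linarith [(abs_le.1 (h₁ a b ha hb)).1])
      fun a b ha hb => by linarith [(abs_le.1 (h₂ a b ha hb)).1]
    simpa using neg_mem_fourQuarters this

/-! ### Concavity of the support function of the slices -/

lemma concaveOn_sqrt_affine {p q : ℝ} (hp : 0 ≤ p) (hq : 0 ≤ q) :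
    ConcaveOn ℝ (Set.Ici 0) fun t : ℝ => √(p + q * t) := by
  refine ⟨convex_Ici 0, fun x hx y hy a b ha hb hab => ?_⟩
  have hx' : 0 ≤ p + q * x := add_nonneg hp (mul_nonneg hq hx)
  have hy' : 0 ≤ p + q * y := add_nonneg hp (mul_nonneg hq hy)
  have h := Real.strictConcaveOn_sqrt.concaveOn.2 (x := p + q * x) (y := p + q * y) hx' hy' ha hb hab
  refine h.trans (le_of_eq ?_)
  simp only [smul_eq_mul]
  congr 1
  linear_combination p * hab

lemma convexOn_inv_of_pos {s : Set ℝ} {f : ℝ → ℝ} (hf : ConcaveOn ℝ s f)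
    (hpos : ∀ x ∈ s, 0 < f x) : ConvexOn ℝ s fun x => (f x)⁻¹ := by
  refine ⟨hf.1, fun x hx y hy a b ha hb hab => ?_⟩
  have h := (convexOn_zpow (𝕜 := ℝ) (-1)).2 (hpos x hx) (hpos y hy) ha hb hab
  simp only [zpow_neg_one, smul_eq_mul] at h ⊢
  refine le_trans (inv_anti₀ ?_ (hf.2 hx hy ha hb hab)) h
  exact (convex_Ioi (0 : ℝ)) (hpos x hx) (hpos y hy) ha hb hab

/-- With `d = p / q`, the function is `(√q - 1) √(d + t) - (√(1 + t) - √(d + t))`. The bracket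
equals `(1 - d) / (√(1 + t) + √(d + t))`, a nonnegative multiple of the reciprocal of a positive
concave function, hence convex. -/
lemma concaveOn_sqrt_sub_sqrt {p q : ℝ} (hp : 0 ≤ p) (hpq : p ≤ q) (hq : 1 ≤ q) :
    ConcaveOn ℝ (Set.Ici 0) fun t : ℝ => √(p + q * t) - √(1 + t) := by
  have hq0 : 0 < q := by linarith
  have hd0 : 0 ≤ p / q := by positivity
  have hd1 : p / q ≤ 1 := (div_le_one hq0).2 hpq
  have hs1 : 1 ≤ √q := Real.one_le_sqrt.2 hq
  have h1 := (concaveOn_sqrt_affine zero_le_one zero_le_one).add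
    (concaveOn_sqrt_affine hd0 zero_le_one)
  have h2 := convexOn_inv_of_pos h1 fun t (ht : 0 ≤ t) => by
    simp only [Pi.add_apply]
    have : 0 < √(1 + 1 * t) := Real.sqrt_pos.2 (by linarith)
    positivity
  have h3 := ((concaveOn_sqrt_affine hd0 zero_le_one).smul (sub_nonneg.2 hs1)).sub
    (h2.smul (sub_nonneg.2 hd1))
  refine h3.congr fun t (ht : 0 ≤ t) => ?_
  have e : p + q * t = q * (p / q + t) := by field_simp
  have hA : 0 < √(1 + t) := Real.sqrt_pos.2 (by linarith)
  have hA2 : √(1 + t) ^ 2 = 1 + t := Real.sq_sqrt (by linarith)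
  have hB2 : √(p / q + t) ^ 2 = p / q + t := Real.sq_sqrt (by positivity)
  have hB := Real.sqrt_nonneg (p / q + t)
  simp only [Pi.sub_apply, Pi.add_apply, smul_eq_mul, one_mul]
  rw [e, Real.sqrt_mul hq0.le, ← div_eq_mul_inv]
  have : (1 - p / q) / (√(1 + t) + √(p / q + t)) = √(1 + t) - √(p / q + t) := by
    rw [div_eq_iff (by positivity)]
    linear_combination hB2 - hA2
  rw [this]
  ring

lemma concaveOn_slice_support (a b : ℝ) (ha : 0 ≤ a) :
    ConcaveOn ℝ (Set.Ici 0) fun t : ℝ =>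
      (a * √(1 + t)) / 2 + √((a * √(1 + t)) ^ 2 / 4 + (b * √t) ^ 2) := by
  have h := ((concaveOn_sqrt_affine zero_le_one zero_le_one).smul (by linarith : 0 ≤ a / 2)).add
    (concaveOn_sqrt_affine (p := a ^ 2 / 4) (q := a ^ 2 / 4 + b ^ 2) (by positivity)
      (by positivity))
  refine h.congr fun t ht => ?_
  have ht : (0 : ℝ) ≤ t := ht
  simp only [Pi.add_apply, smul_eq_mul, mul_pow, Real.sq_sqrt ht,
    Real.sq_sqrt (by linarith : 0 ≤ 1 + t)]
  ring_nf

lemma concaveOn_slice_support_neg (a b : ℝ) (ha : 0 ≤ a) :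
    ConcaveOn ℝ (Set.Ici 0) fun t : ℝ =>
      -((a * √(1 + t)) / 2) + √(9 * (a * √(1 + t)) ^ 2 / 4 + (b * √t) ^ 2) := by
  -- The case `a = 0` is separate because `a / 2` is factored out below, leaving the ratio `b² /
  -- a²`.
  rcases ha.eq_or_lt with rfl | ha
  · refine (concaveOn_sqrt_affine (p := 0) (q := b ^ 2) le_rfl (by positivity)).congr
      fun t ht => ?_
    have ht : (0 : ℝ) ≤ t := ht
    simp [mul_pow, Real.sq_sqrt ht]
  · have h := (concaveOn_sqrt_sub_sqrt (p := 9) (q := 9 + 4 * b ^ 2 / a ^ 2) (by norm_num)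
      (le_add_of_nonneg_right (by positivity))
      (le_add_of_le_of_nonneg (by norm_num) (by positivity))).smul (by linarith : 0 ≤ a / 2)
    refine h.congr fun t ht => ?_
    have ht : (0 : ℝ) ≤ t := ht
    have e : 9 * (a * √(1 + t)) ^ 2 / 4 + (b * √t) ^ 2 =
        (a / 2) ^ 2 * (9 + (9 + 4 * b ^ 2 / a ^ 2) * t) := by
      simp only [mul_pow, Real.sq_sqrt ht, Real.sq_sqrt (by linarith : 0 ≤ 1 + t)]
      field_simp
      ring
    rw [e, Real.sqrt_mul (by positivity), Real.sqrt_sq (by positivity)]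
    simp only [smul_eq_mul]
    ring

/-! ### Convexity and compactness of the twisted set -/

lemma abs_support_le_of_mem {u v a b : ℝ} (h : (u, v) ∈ fourQuarters) (ha : 0 ≤ a)
    (hb : 0 ≤ b) : |a * u + b * v| ≤ a / 2 + √(a ^ 2 / 4 + b ^ 2) :=
  abs_le.2 ⟨by linarith [support_le_of_mem (neg_mem_fourQuarters h) ha hb],
    support_le_of_mem h ha hb⟩

lemma abs_support_neg_le_of_mem {u v a b : ℝ} (h : (u, v) ∈ fourQuarters) (ha : 0 ≤ a)
    (hb : 0 ≤ b) : |-a * u + b * v| ≤ -(a / 2) + √(9 * a ^ 2 / 4 + b ^ 2) :=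
  abs_le.2 ⟨by linarith [support_neg_le_of_mem (neg_mem_fourQuarters h) ha hb],
    support_neg_le_of_mem h ha hb⟩

lemma mk_zero_mem_fourQuarters {u : ℝ} (h : |u| ≤ 1) : (u, (0 : ℝ)) ∈ fourQuarters := by
  obtain ⟨h1, h2⟩ := abs_le.1 h
  rcases le_total (1 / 2) u with hu | hu
  · exact Or.inl (Or.inl (Or.inl ⟨by dsimp only; nlinarith, ⟨hu, h2⟩, by norm_num⟩))
  · exact Or.inl (Or.inl (Or.inr ⟨by dsimp only; nlinarith, ⟨h1, hu⟩, by norm_num⟩))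

/-- A bound by a concave function at two points passes to convex combinations. -/
lemma abs_combo_le_of_concaveOn {f : ℝ → ℝ} (hf : ConcaveOn ℝ (Set.Ici 0) f)
    {p q t₁ t₂ w₁ w₂ : ℝ} (ht₁ : 0 ≤ t₁) (ht₂ : 0 ≤ t₂) (hw₁ : 0 ≤ w₁) (hw₂ : 0 ≤ w₂)
    (hw : w₁ + w₂ = 1) (hp : |p| ≤ f t₁) (hq : |q| ≤ f t₂) :
    |w₁ * p + w₂ * q| ≤ f (w₁ * t₁ + w₂ * t₂) := by
  calc |w₁ * p + w₂ * q| ≤ |w₁ * p| + |w₂ * q| := abs_add_le _ _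
    _ = w₁ * |p| + w₂ * |q| := by rw [abs_mul, abs_mul, abs_of_nonneg hw₁, abs_of_nonneg hw₂]
    _ ≤ w₁ * f t₁ + w₂ * f t₂ := by gcongr
    _ ≤ f (w₁ * t₁ + w₂ * t₂) := hf.2 ht₁ ht₂ hw₁ hw₂ hw

/-- This is convexity of the family of slices, with `t` standing for `r²t`. -/
lemma exists_mem_fourQuarters_combo {u₁ v₁ u₂ v₂ t₁ t₂ w₁ w₂ : ℝ}
    (h₁ : (u₁, v₁) ∈ fourQuarters) (h₂ : (u₂, v₂) ∈ fourQuarters) (ht₁ : 0 ≤ t₁) (ht₂ : 0 ≤ t₂)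
    (hw₁ : 0 ≤ w₁) (hw₂ : 0 ≤ w₂) (hw : w₁ + w₂ = 1) :
    ∃ u v : ℝ, (u, v) ∈ fourQuarters ∧
      w₁ * (u₁ * √(1 + t₁)) + w₂ * (u₂ * √(1 + t₂)) = u * √(1 + (w₁ * t₁ + w₂ * t₂)) ∧
      w₁ * (v₁ * √t₁) + w₂ * (v₂ * √t₂) = v * √(w₁ * t₁ + w₂ * t₂) := by
  have hwt₁ := mul_nonneg hw₁ ht₁
  have hwt₂ := mul_nonneg hw₂ ht₂
  -- At mixed height `0` the slice is a segment and `√t` cannot be divided out. Each point then has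
  -- weight zero or height zero.
  rcases (add_nonneg hwt₁ hwt₂).eq_or_lt with h0 | hpos
  · have hz : ∀ w t : ℝ, w * t = 0 → w * √t = 0 ∧ w * √(1 + t) = w := by
      intro w t h
      rcases mul_eq_zero.1 h with rfl | rfl <;> simp
    obtain ⟨e₁, e₁'⟩ := hz w₁ t₁ (by linarith)
    obtain ⟨e₂, e₂'⟩ := hz w₂ t₂ (by linarith)
    refine ⟨w₁ * u₁ + w₂ * u₂, 0, mk_zero_mem_fourQuarters ?_, ?_, ?_⟩
    · exact abs_combo_le_of_concaveOn (concaveOn_const 1 (convex_Ici 0)) ht₁ ht₂ hw₁ hw₂ hw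
        (abs_le_one_of_mem_fourQuarters h₁).1 (abs_le_one_of_mem_fourQuarters h₂).1
    · rw [← h0, add_zero, Real.sqrt_one]
      linear_combination u₁ * e₁' + u₂ * e₂'
    · linear_combination v₁ * e₁ + v₂ * e₂
  · set t := w₁ * t₁ + w₂ * t₂ with ht
    have hs : 0 < √(1 + t) := Real.sqrt_pos.2 (by linarith)
    have hr : 0 < √t := Real.sqrt_pos.2 hpos
    refine ⟨(w₁ * (u₁ * √(1 + t₁)) + w₂ * (u₂ * √(1 + t₂))) / √(1 + t),
      (w₁ * (v₁ * √t₁) + w₂ * (v₂ * √t₂)) / √t, mem_fourQuarters_of_support ?_ ?_,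
      (div_mul_cancel₀ _ hs.ne').symm, (div_mul_cancel₀ _ hr.ne').symm⟩
    · intro a b ha hb
      -- Dividing `a` and `b` by the stretching factors at the mixed height `t` turns the support
      -- function of that slice into the one of `C` at `(a, b)`.
      have ha' : 0 ≤ a / √(1 + t) := by positivity
      have hb' : 0 ≤ b / √t := by positivity
      have key := abs_combo_le_of_concaveOn
        (concaveOn_slice_support (a / √(1 + t)) (b / √t) ha') ht₁ ht₂ hw₁ hw₂ hw
        (abs_support_le_of_mem h₁ (mul_nonneg ha' (Real.sqrt_nonneg _))
          (mul_nonneg hb' (Real.sqrt_nonneg _)))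
        (abs_support_le_of_mem h₂ (mul_nonneg ha' (Real.sqrt_nonneg _))
          (mul_nonneg hb' (Real.sqrt_nonneg _)))
      rw [← ht, div_mul_cancel₀ _ hs.ne', div_mul_cancel₀ _ hr.ne'] at key
      refine le_of_eq_of_le (congrArg _ ?_) key
      ring
    · intro a b ha hb
      have ha' : 0 ≤ a / √(1 + t) := by positivity
      have hb' : 0 ≤ b / √t := by positivity
      have key := abs_combo_le_of_concaveOn
        (concaveOn_slice_support_neg (a / √(1 + t)) (b / √t) ha') ht₁ ht₂ hw₁ hw₂ hw
        (abs_support_neg_le_of_mem h₁ (mul_nonneg ha' (Real.sqrt_nonneg _))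
          (mul_nonneg hb' (Real.sqrt_nonneg _)))
        (abs_support_neg_le_of_mem h₂ (mul_nonneg ha' (Real.sqrt_nonneg _))
          (mul_nonneg hb' (Real.sqrt_nonneg _)))
      rw [← ht, div_mul_cancel₀ _ hs.ne', div_mul_cancel₀ _ hr.ne'] at key
      refine le_of_eq_of_le (congrArg _ ?_) key
      ring

lemma convex_twistedSet {r : ℝ} (hr : 0 ≤ r) : Convex ℝ (twistedSet r fourQuarters) := by
  rintro _ ⟨u₁, v₁, t₁, h₁, ht₁, rfl⟩ _ ⟨u₂, v₂, t₂, h₂, ht₂, rfl⟩ w₁ w₂ hw₁ hw₂ hw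
  obtain ⟨u, v, huv, hu, hv⟩ := exists_mem_fourQuarters_combo h₁ h₂
    (mul_nonneg (sq_nonneg r) ht₁.1) (mul_nonneg (sq_nonneg r) ht₂.1) hw₁ hw₂ hw
  have e : w₁ * (r ^ 2 * t₁) + w₂ * (r ^ 2 * t₂) = r ^ 2 * (w₁ * t₁ + w₂ * t₂) := by ring
  have hsqrt : ∀ t : ℝ, √(r ^ 2 * t) = r * √t := fun t => by
    rw [Real.sqrt_mul (sq_nonneg r), Real.sqrt_sq hr]
  rw [e] at hu hv
  simp only [hsqrt] at hv
  refine ⟨u, v, w₁ * t₁ + w₂ * t₂, huv, (convex_Icc (0 : ℝ) 1) ht₁ ht₂ hw₁ hw₂ hw, ?_⟩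
  ext i
  fin_cases i
  · simpa using hu
  · simp only [Fin.mk_one, Pi.add_apply, Pi.smul_apply, Matrix.cons_val_one, Matrix.cons_val_zero,
      smul_eq_mul]
    linear_combination hv
  · simp

lemma isCompact_fourQuarters : IsCompact fourQuarters := by
  have hclosed : IsClosed fourQuarters := by
    have aux : ∀ (f : ℝ × ℝ → ℝ), Continuous f → ∀ a b c d : ℝ,
        IsClosed {p : ℝ × ℝ | f p ≤ 1 ∧ p.1 ∈ Set.Icc a b ∧ p.2 ∈ Set.Icc c d} :=
      fun f hf a b c d => (isClosed_le hf continuous_const).inter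
        ((isClosed_Icc.preimage continuous_fst).inter (isClosed_Icc.preimage continuous_snd))
    refine (((aux _ ?_ _ _ _ _).union (aux _ ?_ _ _ _ _)).union (aux _ ?_ _ _ _ _)).union
      (aux _ ?_ _ _ _ _) <;> fun_prop
  refine (isCompact_Icc (a := ((-1 : ℝ), (-1 : ℝ))) (b := (1, 1))).of_isClosed_subset hclosed ?_
  rintro ⟨u, v⟩ h
  obtain ⟨hu, hv⟩ := abs_le_one_of_mem_fourQuarters h
  rw [abs_le] at hu hv
  exact ⟨⟨hu.1, hv.1⟩, hu.2, hv.2⟩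

lemma isCompact_twistedSet (r : ℝ) {E : Set (ℝ × ℝ)} (hE : IsCompact E) :
    IsCompact (twistedSet r E) := by
  have h := (hE.prod (isCompact_Icc (a := (0 : ℝ)) (b := 1))).image
    (f := fun q : (ℝ × ℝ) × ℝ => ![q.1.1 * √(1 + r ^ 2 * q.2), q.1.2 * r * √q.2, q.2])
    (by
      refine continuous_pi fun i => ?_
      fin_cases i <;> simp <;> fun_prop)
  convert h using 1
  ext x
  constructor
  · rintro ⟨u, v, t, huv, ht, rfl⟩
    exact ⟨((u, v), t), ⟨huv, ht⟩, rfl⟩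
  · rintro ⟨⟨⟨u, v⟩, t⟩, ⟨huv, ht⟩, rfl⟩
    exact ⟨u, v, t, huv, ht, rfl⟩

/-! ### The rotation -/

lemma rotationPhi_eq (w : Fin 3 → ℝ) : rotationPhi w =
    ![(√2)⁻¹ * w 0 + (√2)⁻¹ * (√3)⁻¹ * w 1 + (√3)⁻¹ * w 2,
      -(√2)⁻¹ * w 0 + (√2)⁻¹ * (√3)⁻¹ * w 1 + (√3)⁻¹ * w 2,
      -(2 * (√2)⁻¹ * (√3)⁻¹) * w 1 + (√3)⁻¹ * w 2] := by
  have h6 : (√6)⁻¹ = (√2)⁻¹ * (√3)⁻¹ := by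
    rw [← mul_inv, ← Real.sqrt_mul (by norm_num)]
    norm_num
  have h2 : √2 / √3 = 2 * (√2)⁻¹ * (√3)⁻¹ := by
    have := Real.sq_sqrt (show (0 : ℝ) ≤ 2 by norm_num)
    field_simp
    linarith
  ext i
  fin_cases i <;>
    simp [-mul_eq_mul_right_iff, rotationPhi, h6, h2, Matrix.mulVec, dotProduct, Fin.sum_univ_three]

/-- The rotation sends the third axis to the diagonal, so height is a multiple of the coordinate
sum. -/
lemma rotationPhi_add_add (w : Fin 3 → ℝ) :
    rotationPhi w 0 + rotationPhi w 1 + rotationPhi w 2 = 3 * (√3)⁻¹ * w 2 := by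
  simp [rotationPhi_eq]
  ring

lemma continuous_rotationPhi : Continuous rotationPhi :=
  rotationPhi.continuous_of_finiteDimensional

lemma rotationPhi_injective : Function.Injective rotationPhi := by
  rw [injective_iff_map_eq_zero]
  intro w hw
  have hα : 0 < (√2)⁻¹ := by positivity
  have hβ : 0 < (√3)⁻¹ := by positivity
  have hαβ := mul_pos hα hβ
  have h := fun i => congrFun hw i
  have h2' : 3 * (√3)⁻¹ * w 2 = 0 := by rw [← rotationPhi_add_add, h, h, h]; simp
  have h0 := h 0
  have h1 := h 1
  have h2 := h 2
  simp only [rotationPhi_eq, Matrix.cons_val, Pi.zero_apply] at h0 h1 h2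
  have e2 : w 2 = 0 := by simpa [hβ.ne'] using h2'
  have e1 : w 1 = 0 := by
    have : (√2)⁻¹ * (√3)⁻¹ * w 1 = 0 := by rw [e2] at h2; linarith
    exact (mul_eq_zero.1 this).resolve_left hαβ.ne'
  have e0 : w 0 = 0 := by
    have : (√2)⁻¹ * w 0 = 0 := by linarith
    exact (mul_eq_zero.1 this).resolve_left hα.ne'
  ext i
  fin_cases i <;> assumption

/-- Vectors rotated into the positive cone are dominated by their third coordinate. -/
lemma cone_bounds_of_nonneg {k : Fin 3 → ℝ} (h : 0 ≤ rotationPhi k) :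
    |k 1| ≤ 2 * k 2 ∧ |k 0| ≤ 3 * k 2 := by
  have hβ : 0 < (√3)⁻¹ := by positivity
  have hα : 0 < (√2)⁻¹ := by positivity
  have hα2 : (√2)⁻¹ ^ 2 = 1 / 2 := by rw [inv_pow, Real.sq_sqrt (by norm_num)]; norm_num
  have hα1 : 1 / 2 < (√2)⁻¹ := by nlinarith
  have hα1' : (√2)⁻¹ < 1 := by nlinarith
  have hβ2 : (√3)⁻¹ ^ 2 = 1 / 3 := by rw [inv_pow, Real.sq_sqrt (by norm_num)]; norm_num
  have hβ1 : (√3)⁻¹ < 3 / 5 := by nlinarith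
  have h0 := h 0
  have h1 := h 1
  have h2 := h 2
  simp only [rotationPhi_eq, Matrix.cons_val, Pi.zero_apply] at h0 h1 h2
  -- Only the rational bounds on `α` and `β` are needed from here; the constants `2` and `3` are not
  -- sharp.
  generalize (√2)⁻¹ = α at *
  generalize (√3)⁻¹ = β at *
  have hk2 : 0 ≤ k 2 := by
    have : 0 ≤ 3 * β * k 2 := by linarith
    exact nonneg_of_mul_nonneg_right this (by positivity)
  have a1 : 0 ≤ k 2 - 2 * α * k 1 := nonneg_of_mul_nonneg_right (a := β) (by linarith) hβ
  have a2 : 0 ≤ k 2 + α * k 1 := nonneg_of_mul_nonneg_right (a := β) (by linarith) hβ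
  have b1 : |k 1| ≤ 2 * k 2 := abs_le.2 ⟨by nlinarith, by nlinarith⟩
  have b2 : α * β * k 1 ≤ β * k 2 / 2 := by nlinarith
  refine ⟨b1, abs_le.2 ⟨?_, ?_⟩⟩ <;> nlinarith

/-! ### The payoff space and the acceptance set -/

lemma mem_payoffSpace {z : Fin 3 → ℝ} :
    z ∈ payoffSpace ↔ ∃ a c : ℝ, z = rotationPhi ![a, 0, c] := by
  simp only [payoffSpace, Submodule.mem_map, LinearMap.mem_ker, LinearMap.proj_apply]
  constructor
  · rintro ⟨w, hw, rfl⟩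
    refine ⟨w 0, w 2, congrArg _ ?_⟩
    ext i
    fin_cases i <;> simp [hw]
  · rintro ⟨a, c, rfl⟩
    exact ⟨_, rfl, rfl⟩

lemma pricing_apply (z : payoffSpace) : pricing z = (z : Fin 3 → ℝ) 2 := rfl

lemma sum_eq_three_mul_pricing (z : payoffSpace) :
    (z : Fin 3 → ℝ) 0 + (z : Fin 3 → ℝ) 1 + (z : Fin 3 → ℝ) 2 = 3 * pricing z := by
  obtain ⟨a, c, h⟩ := mem_payoffSpace.1 z.2
  rw [pricing_apply, h, rotationPhi_add_add]
  simp [rotationPhi_eq]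
  ring

lemma const_mem_payoffSpace (c : ℝ) : (fun _ : Fin 3 => c) ∈ payoffSpace := by
  refine mem_payoffSpace.2 ⟨0, √3 * c, ?_⟩
  ext i
  fin_cases i <;> simp [rotationPhi_eq]

lemma isClosed_acceptanceSet : IsClosed acceptanceSet :=
  isClosed_Ici.add_left_of_isCompact
    ((isCompact_twistedSet 16 isCompact_fourQuarters).image continuous_rotationPhi)

lemma convex_acceptanceSet : Convex ℝ acceptanceSet :=
  ((convex_twistedSet (by norm_num)).linear_image rotationPhi).add (convex_Ici 0)

lemma zero_mem_acceptanceSet : (0 : Fin 3 → ℝ) ∈ acceptanceSet := by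
  refine ⟨0, ⟨0, ⟨0, 0, 0, mk_zero_mem_fourQuarters (by simp), by simp, ?_⟩, map_zero _⟩, 0,
    le_refl (0 : Fin 3 → ℝ), add_zero _⟩
  ext i
  fin_cases i <;> simp

lemma mem_acceptanceSet_of_le {x y : Fin 3 → ℝ} (hx : x ∈ acceptanceSet) (hxy : x ≤ y) :
    y ∈ acceptanceSet := by
  obtain ⟨b, hb, p, hp, rfl⟩ := hx
  have hp : 0 ≤ p := hp
  exact ⟨b, hb, p + (y - (b + p)), add_nonneg hp (sub_nonneg.2 hxy), by dsimp only; abel⟩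

lemma sum_nonneg_of_mem_twistedSet {r : ℝ} {E : Set (ℝ × ℝ)} {b : Fin 3 → ℝ}
    (hb : b ∈ rotationPhi '' twistedSet r E) : 0 ≤ b 0 + b 1 + b 2 := by
  obtain ⟨_, ⟨u, v, t, -, ht, rfl⟩, rfl⟩ := hb
  rw [rotationPhi_add_add]
  have := ht.1
  simp only [Matrix.cons_val]
  positivity

/-! ### Existence of optimal payoffs -/

/-- Write `z + x = b + p` with `b` in the compact part and `p` in the cone. The coordinate sum of
`b` is nonnegative and that of `z` is three times its price, so a price bound controls the sum of
the nonnegative entries of `p`. -/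
lemma isCompact_feasible (x : Fin 3 → ℝ) (c : ℝ) :
    IsCompact {z : Fin 3 → ℝ | z ∈ payoffSpace ∧ z + x ∈ acceptanceSet ∧ z 2 ≤ c} := by
  have hcl : IsClosed {z : Fin 3 → ℝ | z ∈ payoffSpace ∧ z + x ∈ acceptanceSet ∧ z 2 ≤ c} :=
    (Submodule.closed_of_finiteDimensional payoffSpace).inter
      ((isClosed_acceptanceSet.preimage (continuous_id.add continuous_const)).inter
        (isClosed_le (continuous_apply 2) continuous_const))
  obtain ⟨R, hR⟩ := ((isCompact_twistedSet 16 isCompact_fourQuarters).image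
    continuous_rotationPhi).isBounded.exists_norm_le
  set D := 3 * c + (x 0 + x 1 + x 2)
  refine (Metric.isCompact_of_isClosed_isBounded hcl
    ((Metric.isBounded_Icc (fun i => -R - x i) (fun i => R + D - x i)).subset ?_))
  rintro z ⟨hzM, ⟨b, hb, p, hp, hz⟩, hzc⟩
  have hp : 0 ≤ p := hp
  have hz : ∀ i, b i + p i = z i + x i := fun i => congrFun hz i
  have hs := sum_eq_three_mul_pricing ⟨z, hzM⟩
  rw [pricing_apply] at hs
  dsimp only at hs
  have hb0 := sum_nonneg_of_mem_twistedSet hb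
  have hbR : ∀ i, |b i| ≤ R := fun i => (norm_le_pi_norm b i).trans (hR b hb)
  have hpD : ∀ i, p i ≤ D := by
    have h0 := hp 0
    have h1 := hp 1
    have h2 := hp 2
    simp only [Pi.zero_apply] at h0 h1 h2
    have hsum : p 0 + p 1 + p 2 ≤ D := by linarith [hz 0, hz 1, hz 2]
    intro i
    fin_cases i <;> simp only [Fin.reduceFinMk, Fin.zero_eta, Fin.mk_one] <;> linarith
  refine ⟨fun i => ?_, fun i => ?_⟩
  · have := hp i
    simp only [Pi.zero_apply] at this
    linarith [hz i, (abs_le.1 (hbR i)).1]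
  · linarith [hz i, (abs_le.1 (hbR i)).2, hpD i]

lemma exists_optimal (x : Fin 3 → ℝ) : ∃ z : payoffSpace, (z : Fin 3 → ℝ) + x ∈ acceptanceSet ∧
    ∀ z' : payoffSpace, (z' : Fin 3 → ℝ) + x ∈ acceptanceSet → pricing z ≤ pricing z' := by
  -- The constant payoff `‖x‖` lifts `x` above `0`, so minimizing over prices at most `‖x‖` loses
  -- nothing.
  have hne : (fun _ => ‖x‖) ∈ {z : Fin 3 → ℝ | z ∈ payoffSpace ∧ z + x ∈ acceptanceSet ∧
      z 2 ≤ ‖x‖} := by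
    refine ⟨const_mem_payoffSpace _, mem_acceptanceSet_of_le zero_mem_acceptanceSet fun i => ?_,
      le_rfl⟩
    have := (abs_le.1 (norm_le_pi_norm x i)).1
    simp only [Pi.zero_apply, Pi.add_apply]
    linarith
  obtain ⟨z, ⟨hzM, hzA, hzc⟩, hmin⟩ := (isCompact_feasible x ‖x‖).exists_isMinOn ⟨_, hne⟩
    (continuous_apply 2).continuousOn
  refine ⟨⟨z, hzM⟩, hzA, fun z' hz' => ?_⟩
  rcases le_total (pricing z') ‖x‖ with h | h
  · exact hmin ⟨z'.2, hz', h⟩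
  · exact le_trans hzc h

section General

variable {X : Type*} [AddCommGroup X] [Module ℝ X] {A : Set X} {M : Submodule ℝ X}
  {price : M →ₗ[ℝ] ℝ} {x : X} {z : M}

lemma riskMeasure_eq_of_optimal (hz : (z : X) + x ∈ A)
    (hmin : ∀ z' : M, (z' : X) + x ∈ A → price z ≤ price z') :
    riskMeasure A M price x = (price z : ℝ) := by
  refine IsLeast.csInf_eq ⟨⟨z, hz, rfl⟩, ?_⟩
  rintro _ ⟨z', hz', rfl⟩
  exact EReal.coe_le_coe_iff.2 (hmin z' hz')

lemma mem_optimalSet_iff :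
    z ∈ optimalSet A M price x ↔
      (z : X) + x ∈ A ∧ ∀ z' : M, (z' : X) + x ∈ A → price z ≤ price z' := by
  refine ⟨fun h => ⟨h.1, fun z' hz' => ?_⟩,
    fun h => ⟨h.1, (riskMeasure_eq_of_optimal h.1 h.2).symm⟩⟩
  rw [← EReal.coe_le_coe_iff, h.2]
  exact sInf_le ⟨z', hz', rfl⟩

end General

lemma riskMeasure_eq_coe_toReal (x : Fin 3 → ℝ) :
    riskMeasure acceptanceSet payoffSpace pricing x =
      ((riskMeasure acceptanceSet payoffSpace pricing x).toReal : EReal) := by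
  obtain ⟨z, hz, hmin⟩ := exists_optimal x
  rw [riskMeasure_eq_of_optimal hz hmin, EReal.toReal_coe]

lemma lipschitzWith_riskMeasure :
    LipschitzWith 1 fun x => (riskMeasure acceptanceSet payoffSpace pricing x).toReal := by
  refine LipschitzWith.of_le_add fun x y => ?_
  obtain ⟨z, hz, hmin⟩ := exists_optimal x
  obtain ⟨z', hz', hmin'⟩ := exists_optimal y
  rw [riskMeasure_eq_of_optimal hz hmin, riskMeasure_eq_of_optimal hz' hmin', EReal.toReal_coe,
    EReal.toReal_coe]
  -- Adding the constant `dist x y` to an optimal payoff for `y` makes it feasible for `x` and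
  -- raises its price by exactly `dist x y`.
  refine hmin (z' + ⟨_, const_mem_payoffSpace (dist x y)⟩) (mem_acceptanceSet_of_le hz' ?_)
  intro i
  have := (abs_le.1 ((Real.dist_eq _ _).symm.trans_le (dist_le_pi_dist x y i))).1
  simp only [Pi.add_apply, Submodule.coe_add]
  linarith

lemma admissible_acceptanceSet : Admissible acceptanceSet payoffSpace pricing where
  isClosed := isClosed_acceptanceSet
  convex := convex_acceptanceSet
  zero_mem := zero_mem_acceptanceSet
  monotone _ hx _ hy := mem_acceptanceSet_of_le hx (sub_nonneg.1 hy)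
  noArbitrage z hz hne := by
    have hs := sum_eq_three_mul_pricing z
    have h := fun i => hz i
    simp only [Pi.zero_apply] at h
    refine lt_of_le_of_ne (h 2) fun h0 => hne ?_
    rw [← h0] at hs
    ext i
    have := h 0
    have := h 1
    have := h 2
    fin_cases i <;> simp only [Fin.reduceFinMk, Fin.zero_eta, Fin.mk_one, Pi.zero_apply] <;>
      linarith
  finite x := by
    rw [riskMeasure_eq_coe_toReal]
    exact ⟨EReal.coe_ne_bot _, EReal.coe_ne_top _⟩
  continuous := by
    rw [funext riskMeasure_eq_coe_toReal]
    exact continuous_coe_real_ereal.comp lipschitzWith_riskMeasure.continuous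

/-! ### The optimal payoffs along the perturbations -/

/-- Uniqueness of the top and bottom points of `C` is what makes the optimal sets singletons. -/
lemma eq_half_of_mem_fourQuarters {u ε : ℝ} (hε : ε = 1 ∨ ε = -1) (h : (u, ε) ∈ fourQuarters) :
    u = ε / 2 := by
  have key : ∀ u : ℝ, (u, (1 : ℝ)) ∈ fourQuarters → u = 1 / 2 := by
    intro u h
    simp only [fourQuarters, quarter1, quarter2, quarter3, quarter4, Set.mem_union,
      Set.mem_ofPred_eq, Set.mem_Icc] at h
    rcases h with ((⟨h, ⟨h1, h2⟩, h3, h4⟩ | ⟨h, ⟨h1, h2⟩, h3, h4⟩) | ⟨h, ⟨h1, h2⟩, h3, h4⟩) |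
      ⟨h, ⟨h1, h2⟩, h3, h4⟩ <;> nlinarith
  rcases hε with rfl | rfl
  · exact key u h
  · have := neg_mem_fourQuarters h
    rw [neg_neg] at this
    linarith [key _ this]

lemma half_mem_fourQuarters {ε : ℝ} (hε : ε = 1 ∨ ε = -1) : (ε / 2, ε) ∈ fourQuarters := by
  have h : ((1 / 2 : ℝ), (1 : ℝ)) ∈ fourQuarters :=
    Or.inl (Or.inl (Or.inl ⟨by norm_num, by norm_num, by norm_num⟩))
  rcases hε with rfl | rfl
  · exact h
  · have h := neg_mem_fourQuarters h
    rwa [← neg_div] at h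

/-- The price of a payoff accepted at a perturbation, and the case of equality. -/
lemma accepted_bound {a c ε σ : ℝ} (hε : ε = 1 ∨ ε = -1) (hσ : 0 < σ) (hσ1 : σ ≤ 1)
    (h : rotationPhi ![a, 0, c] + rotationPhi ![0, ε * (16 * σ), 0] ∈ acceptanceSet) :
    σ ^ 2 ≤ c ∧ (c ≤ σ ^ 2 → a = ε / 2 * √(1 + 16 ^ 2 * σ ^ 2)) := by
  obtain ⟨_, ⟨_, ⟨u, v, t, huv, ⟨ht0, ht1⟩, rfl⟩, rfl⟩, p, hp, hpe⟩ := h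
  dsimp only at hpe
  -- The cone component, pulled back by the rotation, has height `c - t` and second coordinate `16
  -- (εσ - v√t)`. The cone bounds make the latter at most `2 (c - t)` in absolute value.
  have hk : 0 ≤ rotationPhi (![a, 0, c] + ![0, ε * (16 * σ), 0] -
      ![u * √(1 + 16 ^ 2 * t), v * 16 * √t, t]) := by
    rw [map_sub, map_add, ← hpe, add_sub_cancel_left]
    exact hp
  obtain ⟨h1, h0⟩ := cone_bounds_of_nonneg hk
  simp only [Pi.sub_apply, Pi.add_apply, Matrix.cons_val, zero_add, add_zero] at h1 h0
  have hct : t ≤ c := by linarith [abs_nonneg (a - u * √(1 + 16 ^ 2 * t))]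
  have hε2 : ε ^ 2 = 1 := by rcases hε with rfl | rfl <;> norm_num
  have hεσ : |ε * σ| ≤ 1 := by
    rw [← sq_le_one_iff_abs_le_one, mul_pow, hε2]
    nlinarith
  have hv := (abs_le_one_of_mem_fourQuarters huv).2
  have hq : (v * √t) ^ 2 ≤ t := by
    rw [mul_pow, Real.sq_sqrt ht0]
    have := (sq_le_one_iff_abs_le_one v).2 hv
    nlinarith
  have hq1 : |v * √t| ≤ 1 := (sq_le_one_iff_abs_le_one _).1 (by linarith)
  have hd : |ε * σ - v * √t| ≤ (c - t) / 8 := by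
    rw [abs_le] at h1 ⊢
    constructor <;> linarith
  -- Together with `v²t ≤ t` this gives `σ² ≤ t + (c - t)/4 ≤ c`. As the factor `1/4` is below `1`,
  -- equality forces `c = t`: the cone component vanishes.
  have hσq : σ ^ 2 - (v * √t) ^ 2 ≤ (c - t) / 4 := by
    have e : σ ^ 2 - (v * √t) ^ 2 = (ε * σ - v * √t) * (ε * σ + v * √t) := by
      linear_combination -σ ^ 2 * hε2
    rw [e]
    refine (le_abs_self _).trans ?_
    rw [abs_mul]
    have : |ε * σ + v * √t| ≤ 2 := (abs_add_le _ _).trans (by linarith)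
    nlinarith [abs_nonneg (ε * σ - v * √t), abs_nonneg (ε * σ + v * √t)]
  refine ⟨by linarith, fun hc => ?_⟩
  obtain rfl : c = t := by linarith
  obtain rfl : c = σ ^ 2 := by linarith
  rw [Real.sqrt_sq hσ.le] at hd
  have hvε : v = ε := by
    have : ε * σ - v * σ = 0 := abs_eq_zero.1 (le_antisymm (by linarith) (abs_nonneg _))
    have : (ε - v) * σ = 0 := by linarith
    rcases mul_eq_zero.1 this with h | h <;> linarith
  subst hvε
  have := abs_eq_zero.1 (le_antisymm (by linarith) (abs_nonneg (a - u * √(1 + 16 ^ 2 * σ ^ 2))))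
  rw [← eq_half_of_mem_fourQuarters hε huv]
  linarith

lemma accepted_of_perturbation {ε σ : ℝ} (hε : ε = 1 ∨ ε = -1) (hσ : 0 ≤ σ) (hσ1 : σ ≤ 1) :
    rotationPhi ![ε / 2 * √(1 + 16 ^ 2 * σ ^ 2), 0, σ ^ 2] + rotationPhi ![0, ε * (16 * σ), 0] ∈
      acceptanceSet := by
  rw [← map_add]
  refine ⟨_, ⟨_, ⟨ε / 2, ε, σ ^ 2, half_mem_fourQuarters hε, ⟨sq_nonneg σ, by nlinarith⟩, rfl⟩,
    rfl⟩, 0, le_refl (0 : Fin 3 → ℝ), ?_⟩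
  rw [Real.sqrt_sq hσ]
  dsimp only
  rw [add_zero]
  congr 1
  ext i
  fin_cases i <;> simp
  ring

lemma optimalSet_perturbation {ε σ : ℝ} (hε : ε = 1 ∨ ε = -1) (hσ : 0 < σ) (hσ1 : σ ≤ 1) :
    Subtype.val '' optimalSet acceptanceSet payoffSpace pricing
        (rotationPhi ![0, ε * (16 * σ), 0]) =
      {rotationPhi ![ε / 2 * √(1 + 16 ^ 2 * σ ^ 2), 0, σ ^ 2]} := by
  have hprice : ∀ (a c : ℝ) (h : rotationPhi ![a, 0, c] ∈ payoffSpace),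
      pricing ⟨_, h⟩ = (√3)⁻¹ * c := fun a c h => by
    simp [pricing_apply, rotationPhi_eq]
  have hβ : 0 < (√3)⁻¹ := by positivity
  have hacc := accepted_of_perturbation hε hσ.le hσ1
  have hM := mem_payoffSpace.2 ⟨ε / 2 * √(1 + 16 ^ 2 * σ ^ 2), σ ^ 2, rfl⟩
  ext w
  rw [Set.mem_singleton_iff]
  constructor
  · rintro ⟨⟨z, hz⟩, hopt, rfl⟩
    obtain ⟨hzA, hmin⟩ := mem_optimalSet_iff.1 hopt
    obtain ⟨a, c, rfl⟩ := mem_payoffSpace.1 hz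
    obtain ⟨h1, h2⟩ := accepted_bound hε hσ hσ1 hzA
    have h := hmin ⟨_, hM⟩ hacc
    rw [hprice, hprice] at h
    have hc := le_of_mul_le_mul_left h hβ
    simp only [h2 hc, le_antisymm hc h1]
  · rintro rfl
    refine ⟨⟨_, hM⟩, mem_optimalSet_iff.2 ⟨hacc, ?_⟩, rfl⟩
    rintro ⟨z, hz⟩ hzA
    obtain ⟨a, c, rfl⟩ := mem_payoffSpace.1 hz
    rw [hprice, hprice]
    exact mul_le_mul_of_nonneg_left (accepted_bound hε hσ hσ1 hzA).1 hβ.le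

lemma perturbation_two_mul (n : ℕ) : perturbation (2 * n) = ![0, 1 * (16 * (√n)⁻¹), 0] := by
  have e : ((2 * n : ℕ) : ℝ) / 2 = n := by
    push_cast
    ring
  rw [perturbation, if_pos (even_two_mul n), e]
  simp [div_eq_mul_inv]

lemma perturbation_two_mul_sub_one {n : ℕ} (hn : 1 ≤ n) :
    perturbation (2 * n - 1) = ![0, -1 * (16 * (√n)⁻¹), 0] := by
  have h : ¬ Even (2 * n - 1) := by
    rw [Nat.not_even_iff_odd]
    exact ⟨n - 1, by omega⟩
  have e : (((2 * n - 1 : ℕ) : ℝ) + 1) / 2 = n := by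
    rw [Nat.cast_sub (by omega)]
    push_cast
    ring
  rw [perturbation, if_neg h, e]
  simp [div_eq_mul_inv]

lemma optimalSet_perturbation_natCast {ε : ℝ} (hε : ε = 1 ∨ ε = -1) {n : ℕ} (hn : 1 ≤ n) :
    Subtype.val '' optimalSet acceptanceSet payoffSpace pricing
        (rotationPhi ![0, ε * (16 * (√n)⁻¹), 0]) =
      {rotationPhi ![ε / 2 * √(1 + 16 ^ 2 / (n : ℝ)), 0, 1 / (n : ℝ)]} := by
  have hn' : (1 : ℝ) ≤ n := by exact_mod_cast hn
  have h1 : 1 ≤ √(n : ℝ) := Real.one_le_sqrt.2 hn'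
  have e : (√(n : ℝ))⁻¹ ^ 2 = 1 / n := by rw [inv_pow, Real.sq_sqrt (by linarith), one_div]
  have h := optimalSet_perturbation hε (σ := (√(n : ℝ))⁻¹) (by positivity) (inv_le_one_of_one_le₀ h1)
  rwa [e, mul_one_div] at h

lemma tendsto_rotationPhi_perturbation :
    Filter.Tendsto (fun k => rotationPhi (perturbation k)) Filter.atTop (nhds 0) := by
  have hs : Filter.Tendsto (fun k : ℕ => 16 / √((k : ℝ) / 2)) Filter.atTop (nhds 0) :=
    Filter.Tendsto.div_atTop tendsto_const_nhds
      (Real.tendsto_sqrt_atTop.comp (tendsto_natCast_atTop_atTop.atTop_div_const two_pos))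
  have hp : Filter.Tendsto perturbation Filter.atTop (nhds 0) := by
    refine squeeze_zero_norm' ?_ hs
    -- Excluding `k = 0` keeps the denominators positive; there `√0 = 0` and the quotient is `0` by
    -- convention.
    filter_upwards [Filter.eventually_ge_atTop 1] with k hk
    have hk : (1 : ℝ) ≤ k := by exact_mod_cast hk
    refine (pi_norm_le_iff_of_nonneg (by positivity)).2 fun i => ?_
    unfold perturbation
    split_ifs
    · fin_cases i <;> simp [abs_of_nonneg] <;> positivity
    · have h : 16 / √(((k : ℝ) + 1) / 2) ≤ 16 / √((k : ℝ) / 2) := by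
        gcongr
        linarith
      fin_cases i
      · simp; positivity
      · simpa [abs_of_nonneg] using h
      · simp; positivity
  have := (continuous_rotationPhi.tendsto 0).comp hp
  rwa [map_zero] at this

lemma tendsto_rotationPhi_payoff (a : ℝ) :
    Filter.Tendsto
      (fun n : ℕ => rotationPhi ![a * √(1 + 16 ^ 2 / (n : ℝ)), 0, 1 / (n : ℝ)])
      Filter.atTop (nhds (rotationPhi ![a, 0, 0])) := by
  refine (continuous_rotationPhi.tendsto _).comp (tendsto_pi_nhds.2 fun i => ?_)
  have h : Filter.Tendsto (fun n : ℕ => a * √(1 + 16 ^ 2 / (n : ℝ))) Filter.atTop (nhds a) := by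
    have h1 := ((tendsto_const_div_atTop_nhds_zero_nat ((16 : ℝ) ^ 2)).const_add 1).sqrt.const_mul a
    simpa using h1
  fin_cases i
  · simpa using h
  · simp
  · simpa using tendsto_inv_atTop_nhds_zero_nat (𝕜 := ℝ)

lemma rotationPhi_neg_half_ne_half :
    rotationPhi ![-(1 / 2), 0, 0] ≠ rotationPhi ![1 / 2, 0, 0] := by
  intro h
  have := congrFun (rotationPhi_injective h) 0
  norm_num at this

/-- A selection has no freedom along the perturbations, so continuity at `0` would make the even and
odd subsequences share the limit `s 0`. -/
lemma not_continuousAt_of_isSelection {s : (Fin 3 → ℝ) → payoffSpace}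
    (hs : IsSelection (optimalSet acceptanceSet payoffSpace pricing) s) : ¬ ContinuousAt s 0 := by
  intro hc
  have hlim : Filter.Tendsto (fun k => (s (rotationPhi (perturbation k)) : Fin 3 → ℝ))
      Filter.atTop (nhds (s 0 : Fin 3 → ℝ)) :=
    (continuous_subtype_val.tendsto _).comp (hc.tendsto.comp tendsto_rotationPhi_perturbation)
  have heven := hlim.comp (Filter.tendsto_id.const_mul_atTop' two_pos)
  -- The subtraction is truncated, but `n ≤ 2 * n - 1` holds even at `n = 0`.
  have hodd := hlim.comp (Filter.tendsto_atTop_mono (f := id) (g := fun n : ℕ => 2 * n - 1)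
    (fun n => by simp only [id]; omega) Filter.tendsto_id)
  have e₁ := tendsto_nhds_unique (heven.congr' (by
    filter_upwards [Filter.eventually_ge_atTop 1] with n hn
    have h := Set.mem_image_of_mem Subtype.val (hs (rotationPhi (perturbation (2 * n))))
    rw [perturbation_two_mul, optimalSet_perturbation_natCast (Or.inl rfl) hn,
      ← perturbation_two_mul] at h
    exact h)) (tendsto_rotationPhi_payoff (1 / 2))
  have e₂ := tendsto_nhds_unique (hodd.congr' (by
    filter_upwards [Filter.eventually_ge_atTop 1] with n hn
    have h := Set.mem_image_of_mem Subtype.val (hs (rotationPhi (perturbation (2 * n - 1))))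
    rw [perturbation_two_mul_sub_one hn, optimalSet_perturbation_natCast (Or.inr rfl) hn,
      ← perturbation_two_mul_sub_one hn] at h
    exact h)) (tendsto_rotationPhi_payoff (-1 / 2))
  rw [neg_div] at e₂
  exact rotationPhi_neg_half_ne_half (e₂.symm.trans e₁)

end RiskSelection

theorem mainTheorem2 :
    -- the triple is admissible, and its (finite) optimal value function is Lipschitz
    Admissible acceptanceSet payoffSpace pricing ∧
    (∃ K : NNReal, LipschitzWith K
      (fun x => (riskMeasure acceptanceSet payoffSpace pricing x).toReal)) ∧
    -- optimal payoffs exist for every position, so that selections exist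
    (∀ x, (optimalSet acceptanceSet payoffSpace pricing x).Nonempty) ∧
    -- along the sequence `Φ(y^(k)) → 0` the sets of optimal payoffs are explicit singletons,
    -- which converge to two different limits
    Filter.Tendsto (fun k => rotationPhi (perturbation k)) Filter.atTop (nhds 0) ∧
    (∀ n : ℕ, 1 ≤ n →
      Subtype.val '' optimalSet acceptanceSet payoffSpace pricing
          (rotationPhi (perturbation (2 * n - 1))) =
        {rotationPhi ![-(1 / 2) * √(1 + 16 ^ 2 / (n : ℝ)), 0, 1 / (n : ℝ)]}) ∧
    (∀ n : ℕ, 1 ≤ n →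
      Subtype.val '' optimalSet acceptanceSet payoffSpace pricing
          (rotationPhi (perturbation (2 * n))) =
        {rotationPhi ![(1 / 2) * √(1 + 16 ^ 2 / (n : ℝ)), 0, 1 / (n : ℝ)]}) ∧
    Filter.Tendsto
      (fun n : ℕ => rotationPhi ![-(1 / 2) * √(1 + 16 ^ 2 / (n : ℝ)), 0, 1 / (n : ℝ)])
      Filter.atTop (nhds (rotationPhi ![-(1 / 2), 0, 0])) ∧
    Filter.Tendsto
      (fun n : ℕ => rotationPhi ![(1 / 2) * √(1 + 16 ^ 2 / (n : ℝ)), 0, 1 / (n : ℝ)])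
      Filter.atTop (nhds (rotationPhi ![1 / 2, 0, 0])) ∧
    rotationPhi ![-(1 / 2), 0, 0] ≠ rotationPhi ![1 / 2, 0, 0] ∧
    -- no selection of the optimal set mapping is continuous at `0`
    (∀ s : (Fin 3 → ℝ) → payoffSpace,
      IsSelection (optimalSet acceptanceSet payoffSpace pricing) s → ¬ ContinuousAt s 0) := by
  refine ⟨admissible_acceptanceSet, ⟨1, lipschitzWith_riskMeasure⟩, fun x => ?_,
    tendsto_rotationPhi_perturbation, fun n hn => ?_, fun n hn => ?_,
    tendsto_rotationPhi_payoff _, tendsto_rotationPhi_payoff _, rotationPhi_neg_half_ne_half,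
    fun s hs => not_continuousAt_of_isSelection hs⟩
  · obtain ⟨z, hz⟩ := exists_optimal x
    exact ⟨z, mem_optimalSet_iff.2 hz⟩
  · rw [perturbation_two_mul_sub_one hn, optimalSet_perturbation_natCast (Or.inr rfl) hn, neg_div]
  · rw [perturbation_two_mul, optimalSet_perturbation_natCast (Or.inl rfl) hn]
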